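/- Let $S$ be a non-compact surface (a second countable topological $2$-manifold without boundary), let $d$ be a metric on $S$ inducing its topology, and let $f:S\to S$ be a homeomorphism. Call a continuous, strictly positive function $S\to\mathbb R$ a gauge. Assume that $f$ is topologically Anosov (TA), that is: (a) (topological expansivity) there is a gauge $\epsilon$ such that for all $x\neq y$ in $S$ there is $k\in\mathbb Z$ with $d(f^k(x),f^k(y))>\epsilon(f^k(x))$; (b) (topological shadowing) for every gauge $\epsilon$ there is a gauge $\delta$ such that for every sequence $(x_n)_{n\in\mathbb Z}$ in $S$ with $d(f(x_n),x_{n+1})<\delta(f(x_n))$ for all $n\in\mathbb Z$ there is $x\in S$ with $d(x_n,f^n(x))<\epsilon(x_n)$ for all $n\in\mathbb Z$. Let $\Omega(f)$ be the non-wandering set of $f$, i.e. the set of all $x\in S$ such that for every open $U\ni x$ there is $n\ge 1$ with $f^n(U)\cap U\ne\emptyset$. A spectral decomposition of $\Omega(f)$ is a family of pairwise disjoint, non-empty closed sets $\Lambda\subset S$ with union $\Omega(f)$, each satisfying $f(\Lambda)=\Lambda$ and such that $f$ is topologically transitive on $\Lambda$ (for all non-empty relatively open $U,V\subset\Lambda$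 there is $n\ge 0$ with $f^n(U)\cap V\neq\emptyset$). The members of a spectral decomposition are called basic sets. Then every basic set of $f$ is compact. -/

import Mathlib

namespace TASurface

section Metric

variable {S : Type*} [MetricSpace S]

/-- A gauge: a continuous, strictly positive function `S → ℝ`. -/
def IsGauge (ε : S → ℝ) : Prop := Continuous ε ∧ ∀ x, 0 < ε x

/-- `f` is topologically expansive. For an integer `k`, `(f ^ k)` is the `k`-th iterate of `f`
in the group of homeomorphisms of `S`. -/
def IsTopologicallyExpansive (f : S ≃ₜ S) : Prop :=
  ∃ ε : S → ℝ, IsGauge ε ∧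
    ∀ x y : S, x ≠ y → ∃ k : ℤ, ε ((f ^ k) x) < dist ((f ^ k) x) ((f ^ k) y)

/-- The bi-infinite sequence `u` is a `δ`-pseudo-orbit of `f`. -/
def IsPseudoOrbit (f : S ≃ₜ S) (δ : S → ℝ) (u : ℤ → S) : Prop :=
  ∀ n : ℤ, dist (f (u n)) (u (n + 1)) < δ (f (u n))

/-- The bi-infinite sequence `u` is `ε`-shadowed by the orbit of `x`. -/
def IsShadowedBy (f : S ≃ₜ S) (ε : S → ℝ) (u : ℤ → S) (x : S) : Prop :=
  ∀ n : ℤ, dist (u n) ((f ^ n) x) < ε (u n)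

/-- `f` has the topological shadowing property. -/
def HasTopologicalShadowing (f : S ≃ₜ S) : Prop :=
  ∀ ε : S → ℝ, IsGauge ε → ∃ δ : S → ℝ, IsGauge δ ∧
    ∀ u : ℤ → S, IsPseudoOrbit f δ u → ∃ x : S, IsShadowedBy f ε u x

/-- `f` is topologically Anosov (TA). -/
def IsTopologicallyAnosov (f : S ≃ₜ S) : Prop :=
  IsTopologicallyExpansive f ∧ HasTopologicalShadowing f

end Metric

section Topological

variable {S : Type*} [TopologicalSpace S]

/-- The non-wandering set `Ω(f)`. -/
def nonwanderingSet (f : S ≃ₜ S) : Set S :=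
  {x | ∀ U : Set S, IsOpen U → x ∈ U → ∃ n : ℕ, 1 ≤ n ∧ ((f ^ n) '' U ∩ U).Nonempty}

/-- `f` is topologically transitive on the set `Λ` (meant for `f '' Λ = Λ`): for any two nonempty
relatively open subsets `U ∩ Λ`, `V ∩ Λ` of `Λ`, some forward iterate of the first one meets
the second one. -/
def IsTransitiveOn (f : S ≃ₜ S) (Λ : Set S) : Prop :=
  ∀ U V : Set S, IsOpen U → IsOpen V → (U ∩ Λ).Nonempty → (V ∩ Λ).Nonempty →
    ∃ n : ℕ, ((f ^ n) '' (U ∩ Λ) ∩ (V ∩ Λ)).Nonempty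

/-- `𝓑` is a spectral decomposition of `Ω(f)`: a family of pairwise disjoint, nonempty, closed
`f`-invariant sets with union `Ω(f)`, on each of which `f` is topologically transitive. -/
structure IsSpectralDecomposition (f : S ≃ₜ S) (𝓑 : Set (Set S)) : Prop where
  sUnion_eq : ⋃₀ 𝓑 = nonwanderingSet f
  pairwiseDisjoint : 𝓑.PairwiseDisjoint id
  nonempty : ∀ Λ ∈ 𝓑, Λ.Nonempty
  isClosed : ∀ Λ ∈ 𝓑, IsClosed Λ
  invariant : ∀ Λ ∈ 𝓑, f '' Λ = Λ
  transitive : ∀ Λ ∈ 𝓑, IsTransitiveOn f Λ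

/-- `Λ` is a basic set of `f`: a member of a spectral decomposition of `Ω(f)`. -/
def IsBasicSet (f : S ≃ₜ S) (Λ : Set S) : Prop :=
  ∃ 𝓑 : Set (Set S), IsSpectralDecomposition f 𝓑 ∧ Λ ∈ 𝓑

end Topological

end TASurface

namespace TASurface

open Filter Topology Set

/-! ### Construction of gauges. -/

section Gauges

variable {S : Type*} [MetricSpace S]

/-! If `Λ` is not compact, transitivity yields points `x n` leaving every compact set with later
iterates tending to `p ∈ Λ`. A shadowing gauge may be so small at `x n` that shadowing there pins
down the iterate near `p`. Following the orbit of `x n`, then jumping to any `w` near `p`, gives in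
the limit that the forward orbits of `w` and `p` stay close (`exists_forward_close_of_escaping`).
For periodic points forward closeness is two-sided, so expansivity allows only one near `p`.
Periodic points accumulate at every point of `Ω(f)` (`exists_periodic_near`), so `p` is periodic and
isolated in `Λ`, and transitivity makes `Λ` finite. -/

/-- A locally solvable family of upward bounds, given by convex sets of positive numbers, is
solved by a gauge. -/
theorem exists_gauge_of_local (t : S → Set ℝ) (ht : ∀ x, Convex ℝ (t x))
    (hpos : ∀ x, ∀ c ∈ t x, 0 < c) (hloc : ∀ x, ∃ c, ∀ᶠ y in 𝓝 x, c ∈ t y) :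
    ∃ ε : S → ℝ, IsGauge ε ∧ ∀ x, ε x ∈ t x := by
  obtain ⟨g, hg⟩ := exists_continuous_forall_mem_convex_of_local_const ht hloc
  exact ⟨g, ⟨g.continuous, fun x => hpos x _ (hg x)⟩, hg⟩

/-- Shadowing evaluates its gauge on the pseudo-orbit, expansivity on the true orbit; this passes
between them. -/
theorem IsGauge.exists_half {e : S → ℝ} (he : IsGauge e) :
    ∃ ε : S → ℝ, IsGauge ε ∧ ∀ u x, dist u x ≤ ε u → 2 * ε u ≤ e x := by
  suffices h : ∃ ε : S → ℝ, IsGauge ε ∧ ∀ y, ε y ∈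
      (fun u => {c : ℝ | 0 < c ∧ ∀ x, dist u x ≤ c → 2 * c ≤ e x}) y by
    obtain ⟨ε, hε, h⟩ := h
    exact ⟨ε, hε, fun u => (h u).2⟩
  refine exists_gauge_of_local _ ?_ (fun _ _ h => h.1) ?_
  · refine fun u => OrdConnected.convex ⟨?_⟩
    rintro a ⟨ha, -⟩ b ⟨-, hb⟩ c ⟨hac, hcb⟩
    exact ⟨ha.trans_le hac, fun x hx => by linarith [hb x (hx.trans hcb)]⟩
  · intro u
    have h1 : ∀ᶠ y in 𝓝 u, e u / 2 < e y :=
      he.1.continuousAt.eventually (lt_mem_nhds (by linarith [he.2 u]))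
    obtain ⟨r, hr, hball⟩ := Metric.eventually_nhds_iff.1 h1
    refine ⟨min (r / 3) (e u / 4), ?_⟩
    filter_upwards [Metric.ball_mem_nhds u (by positivity : 0 < r / 3)] with y hy
    have := he.2 u
    refine ⟨by positivity, fun x hx => ?_⟩
    have h2 := hx.trans (min_le_left _ _)
    have h3 : dist x u < r := by
      have := dist_triangle x y u
      rw [dist_comm x y] at this
      rw [Metric.mem_ball] at hy
      linarith
    have := hball h3
    linarith [min_le_right (r / 3) (e u / 4)]

/-- Below every gauge `e` there is a gauge `c` such that two `c`-approximations of the same point,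
and two points `c`-approximated by the same point, are `e`-close. -/
theorem IsGauge.exists_triangle {e : S → ℝ} (he : IsGauge e) :
    ∃ c : S → ℝ, IsGauge c ∧
      (∀ u v x, dist u x ≤ c u → dist v x ≤ c v → dist u v ≤ e u) ∧
      ∀ u x y, dist u x ≤ c u → dist u y ≤ c u → dist x y ≤ e x := by
  obtain ⟨e₂, he₂, h₂⟩ := he.exists_half
  obtain ⟨c, hc, h⟩ := he₂.exists_half
  refine ⟨c, hc, fun u v x hu hv => ?_, fun u x y hx hy => ?_⟩
  · have h3 := h u x hu
    have h4 := h v x hv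
    have := he₂.2 x
    have h5 := h₂ x u (by rw [dist_comm]; linarith)
    linarith [dist_triangle_right u v x]
  · have h3 := h u x hx
    have := he₂.2 x
    have h5 := h₂ x x (by rw [dist_self]; exact this.le)
    linarith [dist_triangle_left x y u]

theorem IsGauge.min {a b : S → ℝ} (ha : IsGauge a) (hb : IsGauge b) :
    IsGauge fun x => min (a x) (b x) :=
  ⟨ha.1.min hb.1, fun x => lt_min (ha.2 x) (hb.2 x)⟩

theorem isGauge_const {r : ℝ} (hr : 0 < r) : IsGauge fun _ : S => r :=
  ⟨continuous_const, fun _ => hr⟩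

/-- A gauge may be prescribed to be small along a sequence which leaves every compact set. -/
theorem IsGauge.exists_le_of_escaping {e : S → ℝ} (he : IsGauge e) (K : CompactExhaustion S)
    {x : ℕ → S} (hx : ∀ n, x n ∉ K n) {r : ℕ → ℝ} (hr : ∀ n, 0 < r n) :
    ∃ ε : S → ℝ, IsGauge ε ∧ (∀ y, ε y ≤ e y) ∧ ∀ n, ε (x n) ≤ r n := by
  suffices h : ∃ ε : S → ℝ, IsGauge ε ∧ ∀ y, ε y ∈
      (fun y => {c : ℝ | 0 < c ∧ c ≤ e y ∧ ∀ n, x n = y → c ≤ r n}) y by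
    obtain ⟨ε, hε, h⟩ := h
    exact ⟨ε, hε, fun y => (h y).2.1, fun n => (h (x n)).2.2 n rfl⟩
  refine exists_gauge_of_local _ ?_ (fun _ _ h => h.1) ?_
  · refine fun u => OrdConnected.convex ⟨?_⟩
    rintro a ⟨ha, -⟩ b ⟨-, hb, hb'⟩ c ⟨hac, hcb⟩
    exact ⟨ha.trans_le hac, hcb.trans hb, fun n hn => hcb.trans (hb' n hn)⟩
  · intro y
    obtain ⟨N, hN⟩ := K.exists_mem y
    have hey := he.2 y
    -- Only indices `n ≤ N` matter: near `y` all points lie in `K (N + 1)`.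
    have hsmall : ∀ᶠ c in 𝓝[>] (0 : ℝ), (∀ n ∈ Finset.range (N + 1), c < r n) ∧ c < e y / 2 := by
      refine Filter.Eventually.and ((Finset.eventually_all _).2 fun n _ => ?_) ?_
      · exact mem_nhdsWithin_of_mem_nhds (gt_mem_nhds (hr n))
      · exact mem_nhdsWithin_of_mem_nhds (gt_mem_nhds (by positivity))
    obtain ⟨c, ⟨hc1, hc2⟩, hc0⟩ := (hsmall.and self_mem_nhdsWithin).exists
    refine ⟨c, ?_⟩
    filter_upwards [mem_interior_iff_mem_nhds.1 (K.subset_interior_succ N hN),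
      he.1.continuousAt.eventually (lt_mem_nhds (by linarith : e y / 2 < e y))] with z hz hez
    refine ⟨hc0, (hc2.trans hez).le, ?_⟩
    rintro n rfl
    refine (hc1 n (Finset.mem_range.2 ?_)).le
    by_contra hn
    exact hx n (K.subset (not_lt.1 hn) hz)

end Gauges

/-! ### Shadowing, periodic points and compactness. -/

section Dynamics

variable {S : Type*} [MetricSpace S] {f : S ≃ₜ S}

theorem zpow_add_apply (f : S ≃ₜ S) (m n : ℤ) (x : S) : (f ^ (m + n)) x = (f ^ m) ((f ^ n) x) := by
  rw [zpow_add]; rfl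

theorem apply_zpow_apply (f : S ≃ₜ S) (n : ℤ) (x : S) : f ((f ^ n) x) = (f ^ (n + 1)) x := by
  rw [add_comm, zpow_add_apply, zpow_one]

theorem zpow_mul_apply_of_fixed {p : ℤ} {x : S} (h : (f ^ p) x = x) (k : ℤ) :
    (f ^ (p * k)) x = x := by
  rw [zpow_mul]
  have key : ∀ n : ℕ, ((f ^ p) ^ n) x = x := by
    intro n
    induction n with
    | zero => rfl
    | succ n ih =>
      rw [pow_succ]
      change ((f ^ p) ^ n) ((f ^ p) x) = x
      rw [h, ih]
  obtain ⟨n, rfl | rfl⟩ := k.eq_nat_or_neg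
  · rw [zpow_natCast]; exact key n
  · have h1 : ((f ^ p) ^ (-(n : ℤ))) (((f ^ p) ^ (n : ℤ)) x) = x := by
      rw [← zpow_add_apply, neg_add_cancel]; rfl
    rw [zpow_natCast, key n] at h1
    exact h1

theorem symm_apply_mem_iff {Λ : Set S} (h : f '' Λ = Λ) {x : S} :
    f.symm x ∈ Λ ↔ x ∈ Λ := by
  conv_rhs => rw [← h]
  exact ⟨fun hx => ⟨_, hx, f.apply_symm_apply x⟩, by
    rintro ⟨y, hy, rfl⟩; rwa [f.symm_apply_apply]⟩

/-- Periodic points are dense in the non-wandering set of a topologically Anosov homeomorphism. -/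
theorem exists_periodic_near (hf : IsTopologicallyAnosov f) {x : S} (hx : x ∈ nonwanderingSet f)
    {ρ : ℝ} (hρ : 0 < ρ) : ∃ z, dist z x < ρ ∧ ∃ n : ℤ, 0 < n ∧ (f ^ n) z = z := by
  obtain ⟨⟨e, he, hexp⟩, hsh⟩ := hf
  obtain ⟨c, hc, -, hct⟩ := he.exists_triangle
  obtain ⟨δ, hδ, hshadow⟩ := hsh _ (hc.min (isGauge_const (half_pos hρ)))
  have hδx := hδ.2 x
  obtain ⟨n, hn, b, ⟨a, ⟨⟨haρ, haδ⟩, -⟩, rfl⟩, ⟨⟨-, hbδ⟩, hb⟩⟩ :=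
    hx ((Metric.ball x (ρ / 2) ∩ Metric.ball x (δ x / 4)) ∩ {y | δ x / 2 < δ y})
    ((Metric.isOpen_ball.inter Metric.isOpen_ball).inter (isOpen_lt continuous_const hδ.1))
    ⟨⟨Metric.mem_ball_self (by positivity), Metric.mem_ball_self (by positivity)⟩,
      half_lt_self hδx⟩
  rw [Metric.mem_ball] at haρ haδ hbδ
  have hn0 : (0 : ℤ) < n := by exact_mod_cast hn
  have hjump : dist ((f ^ n) a) a < δ ((f ^ n) a) := by
    have := dist_triangle_right ((f ^ n) a) a x
    have : δ x / 2 < δ ((f ^ n) a) := hb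
    linarith
  -- Since this pseudo-orbit is `n`-periodic, `z` and `(f ^ n) z` both shadow it, and expansivity
  -- identifies them.
  obtain ⟨z, hz⟩ := hshadow (fun k => (f ^ (k % (n : ℤ))) a) <| by
    intro k
    have h1 := Int.emod_nonneg k hn0.ne'
    have h2 := Int.emod_lt_of_pos k hn0
    simp only [apply_zpow_apply, ← Int.emod_add_emod k n 1]
    by_cases h : k % (n : ℤ) + 1 = n
    · rw [h, Int.emod_self, zpow_natCast, zpow_zero]
      exact hjump
    · rw [Int.emod_eq_of_lt (a := k % n + 1) (by omega) (by omega), dist_self]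
      exact hδ.2 _
  refine ⟨z, ?_, n, hn0, ?_⟩
  · have h0 := (hz 0).trans_le (min_le_right _ _)
    simp only [Int.zero_emod, zpow_zero] at h0
    have h0 : dist a z < ρ / 2 := h0
    linarith [dist_triangle_left z x a]
  · by_contra hne
    obtain ⟨k, hk⟩ := hexp _ _ hne
    have h1 := (hz k).le.trans (min_le_left _ _)
    have h2 := (hz (k + n)).le.trans (min_le_left _ _)
    simp only [Int.add_emod_right] at h2
    rw [← zpow_add_apply] at hk
    exact hk.not_ge (hct _ _ _ h2 h1)

/-- If a sequence leaves every compact set but later iterates of it converge to `p`, then the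
forward orbit of `p` stays close to the forward orbits of all points near `p`. -/
theorem exists_forward_close_of_escaping (hsh : HasTopologicalShadowing f)
    (K : CompactExhaustion S) {x : ℕ → S} (hx : ∀ n, x n ∉ K n) {m : ℕ → ℤ} (hm : ∀ n, 0 < m n)
    {p : S} (hp : Tendsto (fun n => (f ^ m n) (x n)) atTop (𝓝 p)) {c : S → ℝ} (hc : IsGauge c) :
    ∃ r > 0, ∀ w, dist p w < r → ∀ k : ℤ, 0 ≤ k → dist ((f ^ k) w) ((f ^ k) p) ≤ c ((f ^ k) w) := by
  have hcont : ∀ n : ℕ, ∃ r > 0, ∀ z, dist z (x n) < r →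
      dist ((f ^ m n) z) ((f ^ m n) (x n)) < 1 / ((n : ℝ) + 1) := fun n =>
    Metric.continuous_iff.1 (f ^ m n).continuous (x n) _ Nat.one_div_pos_of_nat
  choose r hr hrx using hcont
  obtain ⟨ε, hε, hεc, hεr⟩ := hc.exists_le_of_escaping K hx hr
  obtain ⟨δ, hδ, hshadow⟩ := hsh ε hε
  refine ⟨δ p, hδ.2 p, fun w hw k hk => ?_⟩
  have hev : ∀ᶠ n in atTop, dist ((f ^ m n) (x n)) w < δ ((f ^ m n) (x n)) :=
    (hp.dist tendsto_const_nhds).eventually_lt ((hδ.1.tendsto p).comp hp) hw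
  have hev' : ∀ᶠ n in atTop, ∃ z, dist z ((f ^ m n) (x n)) < 1 / ((n : ℝ) + 1) ∧
      dist ((f ^ k) w) ((f ^ k) z) ≤ c ((f ^ k) w) := by
    filter_upwards [hev] with n hn
    have hmn := hm n
    -- The only jump is from `(f ^ m n) (x n)` to `w`, at time `m n`.
    obtain ⟨z, hz⟩ := hshadow
        (fun j => if j < m n then (f ^ j) (x n) else (f ^ (j - m n)) w) <| by
      intro j
      rcases lt_trichotomy (j + 1) (m n) with h | h | h
      · simp only [if_pos h, if_pos (show j < m n by omega), apply_zpow_apply, dist_self]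
        exact hδ.2 _
      · simp only [if_pos (show j < m n by omega), apply_zpow_apply, h, lt_irrefl, if_false,
          sub_self, zpow_zero]
        exact hn
      · simp only [if_neg (show ¬ j < m n by omega), if_neg (show ¬ j + 1 < m n by omega),
          apply_zpow_apply, show j + 1 - m n = j - m n + 1 by ring, dist_self]
        exact hδ.2 _
    refine ⟨(f ^ m n) z, hrx n z ?_, ?_⟩
    · have h0 := hz 0
      simp only [if_pos hmn] at h0
      rw [dist_comm]
      exact h0.trans_le (hεr n)
    · have h1 := hz (k + m n)
      simp only [if_neg (show ¬ k + m n < m n by omega), add_sub_cancel_right,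
        zpow_add_apply] at h1
      exact h1.le.trans (hεc _)
  obtain ⟨N, hN⟩ := eventually_atTop.1 hev'
  have hN' : ∀ n, ∃ z, N ≤ n → dist z ((f ^ m n) (x n)) < 1 / ((n : ℝ) + 1) ∧
      dist ((f ^ k) w) ((f ^ k) z) ≤ c ((f ^ k) w) := fun n => by
    by_cases hn : N ≤ n
    · exact (hN n hn).imp fun _ h _ => h
    · exact ⟨p, fun h => absurd h hn⟩
  choose z hz using hN'
  have hzp : Tendsto z atTop (𝓝 p) := by
    refine (tendsto_iff_of_dist ?_).2 hp
    refine squeeze_zero' (Eventually.of_forall fun _ => dist_nonneg) ?_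
      tendsto_one_div_add_atTop_nhds_zero_nat
    filter_upwards [eventually_ge_atTop N] with n hn using (hz n hn).1.le
  refine le_of_tendsto (tendsto_const_nhds.dist (((f ^ k).continuous.tendsto p).comp hzp)) ?_
  filter_upwards [eventually_ge_atTop N] with n hn using (hz n hn).2

/-- Two periodic points whose forward orbits are close coincide. -/
theorem eq_of_periodic_of_forward_close {e : S → ℝ}
    (hexp : ∀ x y : S, x ≠ y → ∃ k : ℤ, e ((f ^ k) x) < dist ((f ^ k) x) ((f ^ k) y))
    {v w : S} {a b : ℤ} (ha : 0 < a) (hb : 0 < b) (hv : (f ^ a) v = v) (hw : (f ^ b) w = w)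
    (h : ∀ k : ℤ, 0 ≤ k → dist ((f ^ k) v) ((f ^ k) w) ≤ e ((f ^ k) v)) : v = w := by
  by_contra hne
  obtain ⟨k, hk⟩ := hexp _ _ hne
  -- Reduction modulo the common period `a * b` turns any time into a nonnegative one.
  have h1 := h (k % (a * b)) (Int.emod_nonneg k (mul_pos ha hb).ne')
  have h2 : ∀ y, (f ^ (a * b)) y = y → (f ^ (k % (a * b))) y = (f ^ k) y := fun y hy => by
    conv_rhs => rw [← Int.emod_add_mul_ediv k (a * b), zpow_add_apply, zpow_mul_apply_of_fixed hy]
  rw [h2 v (zpow_mul_apply_of_fixed hv b),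
    h2 w (by rw [mul_comm]; exact zpow_mul_apply_of_fixed hw a)] at h1
  exact hk.not_ge h1

/-- A closed transitive set with an isolated periodic point is compact. -/
theorem IsTransitiveOn.isCompact_of_isolated_periodic {Λ : Set S} (hΛ : IsTransitiveOn f Λ)
    (hcl : IsClosed Λ) {p : S} {W : Set S} (hW : IsOpen W) (hWΛ : W ∩ Λ = {p}) {a : ℤ}
    (ha : 0 < a) (hp : (f ^ a) p = p) : IsCompact Λ := by
  have hfin : ((fun k : ℤ => (f ^ k) p) '' Ico 0 a).Finite := (finite_Ico 0 a).image _
  refine hfin.isCompact.of_isClosed_subset hcl fun y hy => ?_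
  by_contra hny
  obtain ⟨n, z, ⟨q, hq, rfl⟩, hz, -⟩ := hΛ W _ hW hfin.isClosed.isOpen_compl
    (by rw [hWΛ]; exact singleton_nonempty p) ⟨y, hny, hy⟩
  rw [hWΛ, mem_singleton_iff] at hq
  subst hq
  refine hz ⟨(n : ℤ) % a, ⟨Int.emod_nonneg _ ha.ne', Int.emod_lt_of_pos _ ha⟩, ?_⟩
  change (f ^ ((n : ℤ) % a)) q = (f ^ n) q
  rw [← zpow_natCast]
  conv_rhs => rw [← Int.emod_add_mul_ediv (n : ℤ) a, zpow_add_apply, zpow_mul_apply_of_fixed hp]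

/-- A closed transitive invariant set of non-wandering points of a topologically Anosov
homeomorphism of a σ-compact locally compact metric space is compact. -/
theorem IsTransitiveOn.isCompact [WeaklyLocallyCompactSpace S] [SigmaCompactSpace S]
    (hf : IsTopologicallyAnosov f) {Λ : Set S} (hΛ : IsTransitiveOn f Λ) (hcl : IsClosed Λ)
    (hinv : f '' Λ = Λ) (hne : Λ.Nonempty) (hΩ : Λ ⊆ nonwanderingSet f) : IsCompact Λ := by
  by_contra hnc
  obtain ⟨p, hp⟩ := hne
  let K := CompactExhaustion.choice S
  have hseq : ∀ n : ℕ, ∃ x, x ∉ K n ∧ ∃ m : ℤ, 0 < m ∧ dist ((f ^ m) x) p < 1 / ((n : ℝ) + 1) := by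
    intro n
    have hU : ((K n)ᶜ ∩ Λ).Nonempty := by
      by_contra hempty
      refine hnc ((K.isCompact n).of_isClosed_subset hcl fun y hy => ?_)
      by_contra hyK
      exact hempty ⟨y, hyK, hy⟩
    -- Transitivity may return time `0`; aiming at the preimage makes the total time positive.
    have hV : (f ⁻¹' Metric.ball p (1 / ((n : ℝ) + 1)) ∩ Λ).Nonempty := by
      refine ⟨f.symm p, ?_, (symm_apply_mem_iff hinv).2 hp⟩
      rw [mem_preimage, f.apply_symm_apply]
      exact Metric.mem_ball_self Nat.one_div_pos_of_nat
    obtain ⟨k, y, ⟨x, ⟨hxK, -⟩, rfl⟩, hy, -⟩ := hΛ _ _ (K.isCompact n).isClosed.isOpen_compl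
      (Metric.isOpen_ball.preimage f.continuous) hU hV
    refine ⟨x, hxK, (k : ℤ) + 1, by omega, ?_⟩
    rw [← apply_zpow_apply, zpow_natCast]
    exact hy
  choose x hxK m hm hxm using hseq
  have hlim : Tendsto (fun n => (f ^ m n) (x n)) atTop (𝓝 p) :=
    tendsto_iff_dist_tendsto_zero.2 <| squeeze_zero (fun _ => dist_nonneg)
      (fun n => (hxm n).le) tendsto_one_div_add_atTop_nhds_zero_nat
  obtain ⟨e, he, hexp⟩ := hf.1
  obtain ⟨c, hc, hct, -⟩ := he.exists_triangle
  obtain ⟨r, hr, hclose⟩ := exists_forward_close_of_escaping hf.2 K hxK hm hlim hc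
  obtain ⟨w, hwp, a, ha, hw⟩ := exists_periodic_near hf (hΩ hp) hr
  have huniq : ∀ y ∈ Metric.ball p r ∩ Λ, y = w := by
    rintro y ⟨hy, hyΛ⟩
    by_contra hyw
    rw [Metric.mem_ball] at hy
    -- `v` is closer to `y` than `w` is, yet uniqueness will force `v = w`.
    obtain ⟨v, hvy, b, hb, hv⟩ := exists_periodic_near hf (hΩ hyΛ)
      (lt_min (sub_pos.2 hy) (dist_pos.2 hyw))
    have hvp : dist v p < r := by
      linarith [dist_triangle v y p, hvy.trans_le (min_le_left _ _)]
    have hvw : v = w := eq_of_periodic_of_forward_close hexp hb ha hv hw fun k hk =>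
      hct _ _ ((f ^ k) p) (hclose v (by rwa [dist_comm]) k hk)
        (hclose w (by rwa [dist_comm]) k hk)
    have := hvy.trans_le (min_le_right _ _)
    rw [hvw, dist_comm] at this
    exact lt_irrefl _ this
  have hpw : p = w := huniq p ⟨Metric.mem_ball_self hr, hp⟩
  refine hnc (hΛ.isCompact_of_isolated_periodic hcl Metric.isOpen_ball (W := Metric.ball p r)
    (p := p) ?_ ha (by rw [hpw]; exact hw))
  refine Subset.antisymm (fun y hy => (huniq y hy).trans hpw.symm) ?_
  exact singleton_subset_iff.2 ⟨Metric.mem_ball_self hr, hp⟩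

end Dynamics

end TASurface

theorem mainTheorem5 {S : Type*} [MetricSpace S] [SecondCountableTopology S]
    [ChartedSpace (EuclideanSpace ℝ (Fin 2)) S] [NoncompactSpace S]
    (f : S ≃ₜ S) (hf : TASurface.IsTopologicallyAnosov f)
    (Λ : Set S) (hΛ : TASurface.IsBasicSet f Λ) : IsCompact Λ := by
  obtain ⟨𝓑, h𝓑, hmem⟩ := hΛ
  have : LocallyCompactSpace S := ChartedSpace.locallyCompactSpace (EuclideanSpace ℝ (Fin 2)) S
  exact (h𝓑.transitive Λ hmem).isCompact hf (h𝓑.isClosed Λ hmem) (h𝓑.invariant Λ hmem)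
    (h𝓑.nonempty Λ hmem) (h𝓑.sUnion_eq ▸ Set.subset_sUnion_of_mem hmem)
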